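/- For integers $n\ge 3$ and $j,k\ge 1$ with $j,k<n/2$, let $I(n,j,k)$ be the simple graph with the $2n$ vertices $u_0,\dots,u_{n-1},w_0,\dots,w_{n-1}$ and the edges $u_iu_{i+j}$, $w_iw_{i+k}$ and $u_iw_i$ for $0\le i<n$, the subscripts being taken modulo $n$; let $G(n,k)=I(n,1,k)$ be the generalized Petersen graph. A simple graph is called $[1,\lambda,8]$-cycle regular if every path on two vertices (that is, every edge) belongs to exactly $\lambda$ different cycles of length $8$. **Theorem.** Let $n\ge 3$ and let $j,k\ge 1$ be integers with $j,k<n/2$ and $\gcd(n,j,k)=1$ (equivalently, $I(n,j,k)$ is connected). Then there is an integer $\lambda\ge 0$ such that $I(n,j,k)$ is $[1,\lambda,8]$-cycle regular if and only if $I(n,j,k)$ is isomorphic to $G(n',k')=I(n',1,k')$ for some \[(n',k')\in\{(3,1),(4,1),(5,2),(8,3),(10,2),(10,3),(12,5),(13,5),(24,5),(26,5)\}.\] -/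

import Mathlib

namespace SimpleGraph

/-- A subgraph `C` of `G` is a cycle of length `m` if it is the subgraph traced out by some closed
walk of length `m` that is a cycle. Two closed walks that differ only by the starting vertex or
the direction give the same subgraph. -/
def IsCycleOfLength {V : Type*} {G : SimpleGraph V} (C : G.Subgraph) (m : ℕ) : Prop :=
  ∃ (v : V) (c : G.Walk v v), c.IsCycle ∧ c.length = m ∧ c.toSubgraph = C

/-- `G` is `[l, r, m]`-cycle regular if every path on `l + 1` vertices (that is, of length `l`)
belongs to exactly `r` different cycles of length `m`. -/
def IsCycleRegular {V : Type*} (G : SimpleGraph V) (l r m : ℕ) : Prop :=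
  ∀ (u v : V) (p : G.Walk u v), p.IsPath → p.length = l →
    {C : G.Subgraph | IsCycleOfLength C m ∧ p.toSubgraph ≤ C}.encard = (r : ℕ∞)

end SimpleGraph

/-- The `I`-graph `I(n, j, k)`. The vertex `u_a` is `Sum.inl a` and the vertex `w_a` is `Sum.inr a`,
with `a` an integer modulo `n`. The edges are the outer edges `u_a u_{a+j}`, the inner edges
`w_a w_{a+k}` and the spokes `u_a w_a`. -/
def iGraph (n j k : ℕ) : SimpleGraph (ZMod n ⊕ ZMod n) :=
  SimpleGraph.fromRel fun x y =>
    match x, y with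
    | Sum.inl a, Sum.inl b => b = a + (j : ZMod n)
    | Sum.inr a, Sum.inr b => b = a + (k : ZMod n)
    | Sum.inl a, Sum.inr b => b = a
    | Sum.inr _, Sum.inl _ => False

/-- The generalized Petersen graph `G(n, k) = I(n, 1, k)`. -/
def generalizedPetersen (n k : ℕ) : SimpleGraph (ZMod n ⊕ ZMod n) :=
  iGraph n 1 k

/-! An 8-cycle through an edge is that edge closed up by a path of length 7 between its ends. Walks
in `I(n, j, k)` are words in three letters (spoke, forward, backward), and two visited positions
coincide exactly when they share a layer and their displacement `(x, y)` lies in the lattice `L` of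
pairs with `n ∣ x * j + y * k`. Whether a word closes an edge up to an 8-cycle thus depends only on
`L`. An enumeration of the words of length 7 leaves a short list of cycle types, each with a fixed
weight for outer edges, inner edges and spokes; by `isCycleRegular_iff`, regularity means that the
three weighted sums agree.

Since `gcd(n, j, k) = 1`, the determinant of any two vectors of `L` is divisible by `n`
(`dvd_det_of_mem_relationLattice`). The closing displacements of the two-spoke types have pairwise
determinants that are nonzero and at most 26 in absolute value, so for `n > 26` at most one such
type occurs, and the equations become contradictory (`le_of_counts_eq`). The cases `n ≤ 26` are
computed: every solution is carried to a listed graph by a unit multiplier, after a swap of the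
layers if needed. Conversely, the listed graphs satisfy the equations, and regularity is invariant
under isomorphism. -/

namespace SimpleGraph

/-! ### Cycles through an edge as paths between its ends -/

variable {V : Type*} {G : SimpleGraph V}

/-- A path has only one edge at its initial vertex, so its edge set determines the first step, and
induction gives the rest. This lets cycles, which are subgraphs, be counted by paths. -/
theorem Walk.IsPath.eq_of_mem_edges_iff {u v : V} {p q : G.Walk u v} (hp : p.IsPath)
    (hq : q.IsPath) (h : ∀ e, e ∈ p.edges ↔ e ∈ q.edges) : p = q := by
  induction p with
  | nil => exact (Walk.isPath_iff_nil.1 hq).eq_nil.symm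
  | @cons a b c hab p ih =>
    cases q with
    | nil => simp at hp
    | @cons _ d _ had q =>
      rw [Walk.cons_isPath_iff] at hp hq
      have key : ∀ {x y z : V} (hay : G.Adj a y) (r : G.Walk y z), a ∉ r.support →
          s(a, x) ∈ (Walk.cons hay r).edges → x = y := by
        intro x y z hay r hr hx
        rw [Walk.edges_cons, List.mem_cons] at hx
        rcases hx with hx | hx
        · exact Sym2.congr_right.1 hx
        · exact absurd (r.fst_mem_support_of_mem_edges hx) hr
      have hbd : b = d := key had q hq.2 ((h _).1 (by simp))
      subst hbd
      congr 1
      refine ih hp.1 hq.1 fun e => ?_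
      have he := h e
      simp only [Walk.edges_cons, List.mem_cons] at he
      have hp' : s(a, b) ∉ p.edges := fun h' => hp.2 (p.fst_mem_support_of_mem_edges h')
      have hq' : s(a, b) ∉ q.edges := fun h' => hq.2 (q.fst_mem_support_of_mem_edges h')
      by_cases heq : e = s(a, b)
      · subst heq; tauto
      · tauto

theorem Walk.IsPath.exists_eq_concat_of_mem_edges {u v w : V} {p : G.Walk u v} (hp : p.IsPath)
    (h : s(w, v) ∈ p.edges) : ∃ (q : G.Walk u w) (hwv : G.Adj w v), p = q.concat hwv := by
  induction p with
  | nil => simp at h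
  | @cons a b c hab p ih =>
    rw [Walk.cons_isPath_iff] at hp
    rw [Walk.edges_cons, List.mem_cons] at h
    rcases h with h | h
    · have hac : a ≠ c := fun hac => hp.2 (hac ▸ p.end_mem_support)
      have hw : w = a ∧ c = b := by
        rcases Sym2.eq_iff.1 h with h | h
        · exact h
        · exact absurd h.2.symm hac
      obtain ⟨rfl, rfl⟩ := hw
      have := (Walk.isPath_iff_nil.1 hp.1).eq_nil
      subst this
      exact ⟨Walk.nil, hab, rfl⟩
    · obtain ⟨q, hwv, rfl⟩ := ih hp.1 h
      exact ⟨Walk.cons hab q, hwv, rfl⟩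

/-- Every cycle of length `m + 1` through an edge `uv` is closed up from a unique path of length
`m` from `v` to `u`. -/
theorem encard_cycles_through_adj {u v : V} (h : G.Adj u v) {m : ℕ} (hm : 2 ≤ m) :
    {C : G.Subgraph | IsCycleOfLength C (m + 1) ∧ h.toWalk.toSubgraph ≤ C}.encard =
      {q : G.Walk v u | q.IsPath ∧ q.length = m}.encard := by
  -- A path from `v` to `u` that uses the edge `uv` is that single edge, which `2 ≤ m` excludes.
  have hedge : ∀ q : G.Walk v u, q.IsPath → q.length = m → s(u, v) ∉ q.edges := by
    intro q hq hl he
    rw [Sym2.eq_swap] at he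
    obtain ⟨r, hr, rfl⟩ := hq.exists_eq_concat_of_mem_edges he
    have : r = Walk.nil := by
      rw [Walk.concat_eq_append] at hq
      exact (Walk.isPath_iff_nil.1 hq.of_append_left).eq_nil
    subst this
    simp [Walk.concat] at hl
    omega
  symm
  have hinj : Set.InjOn (fun q : G.Walk v u => (Walk.cons h q).toSubgraph)
      {q : G.Walk v u | q.IsPath ∧ q.length = m} := by
    rintro p ⟨hp, hpl⟩ q ⟨hq, hql⟩ hpq
    refine hp.eq_of_mem_edges_iff hq fun e => ?_
    have he : e ∈ (Walk.cons h p).edges ↔ e ∈ (Walk.cons h q).edges := by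
      rw [← Walk.mem_edges_toSubgraph, ← Walk.mem_edges_toSubgraph]
      simp only at hpq
      rw [hpq]
    simp only [Walk.edges_cons, List.mem_cons] at he
    have := hedge p hp hpl
    have := hedge q hq hql
    by_cases heq : e = s(u, v)
    · subst heq; tauto
    · tauto
  rw [← hinj.encard_image]
  congr 1
  ext C
  simp only [Set.mem_image, Set.mem_ofPred_eq]
  constructor
  · rintro ⟨q, ⟨hq, hl⟩, rfl⟩
    refine ⟨⟨u, Walk.cons h q, ?_, by simp [hl], rfl⟩, ?_⟩
    · exact (Walk.cons_isCycle_iff q h).2 ⟨hq, hedge q hq hl⟩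
    · simp [Walk.toSubgraph]
  · rintro ⟨⟨x, c, hc, hl, rfl⟩, hle⟩
    classical
    have he : s(u, v) ∈ c.edges := by
      rw [← Walk.mem_edges_toSubgraph]
      exact Subgraph.edgeSet_mono hle (by simp [Walk.toSubgraph])
    have hu : u ∈ c.support := c.fst_mem_support_of_mem_edges he
    obtain ⟨c', hc', hl', hs', he'⟩ : ∃ c' : G.Walk u u, c'.IsCycle ∧ c'.length = m + 1 ∧
        c'.toSubgraph = c.toSubgraph ∧ s(u, v) ∈ c'.edges :=
      ⟨c.rotate u hu, hc.rotate hu, by simpa using hl, by simp, by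
        rw [← Walk.mem_edges_toSubgraph]; simpa using he⟩
    rw [← hs']
    cases c' with
    | nil => simp at hl'
    | @cons _ b _ hub q =>
      obtain ⟨hq, hnot⟩ := (Walk.cons_isCycle_iff q hub).1 hc'
      -- The rotated cycle has the edge `uv` either first or last; in the second case it is
      -- traversed backwards.
      by_cases hbv : b = v
      · subst hbv
        exact ⟨q, ⟨hq, by simpa using hl'⟩, rfl⟩
      · rw [Walk.edges_cons, List.mem_cons] at he'
        have he'' : s(v, u) ∈ q.edges := by
          rcases he' with he' | he'
          · exact absurd (Sym2.congr_right.1 he').symm hbv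
          · rwa [Sym2.eq_swap]
        obtain ⟨r, hvu, rfl⟩ := hq.exists_eq_concat_of_mem_edges he''
        refine ⟨(Walk.cons hub r).reverse, ⟨?_, by simpa using hl'⟩, ?_⟩
        · rw [Walk.isPath_reverse_iff, Walk.cons_isPath_iff]
          rw [Walk.concat_isPath_iff] at hq
          exact hq
        · have : Walk.cons h (Walk.cons hub r).reverse =
              (Walk.cons hub (r.concat hvu)).reverse := by
            rw [← Walk.concat_cons, Walk.reverse_concat]
          rw [this, Walk.toSubgraph_reverse]

theorem isCycleRegular_one_iff {r m : ℕ} (hm : 2 ≤ m) :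
    G.IsCycleRegular 1 r (m + 1) ↔ ∀ u v : V, G.Adj u v →
      {q : G.Walk v u | q.IsPath ∧ q.length = m}.encard = r := by
  constructor
  · intro H u v h
    rw [← encard_cycles_through_adj h hm]
    exact H u v h.toWalk (by simp [h.ne]) rfl
  · intro H u v p hp hl
    cases p with
    | nil => simp at hl
    | cons h p =>
      cases p with
      | nil => rw [← H _ _ h, ← encard_cycles_through_adj h hm]
      | cons h' p => simp at hl

theorem encard_paths_symm (u v : V) (m : ℕ) :
    {q : G.Walk v u | q.IsPath ∧ q.length = m}.encard =
      {q : G.Walk u v | q.IsPath ∧ q.length = m}.encard := by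
  have hinj : Function.Injective (Walk.reverse : G.Walk v u → G.Walk u v) :=
    fun p q h => by rw [← p.reverse_reverse, h, Walk.reverse_reverse]
  rw [← hinj.encard_image]
  congr 1
  ext q
  constructor
  · rintro ⟨p, ⟨hp, hl⟩, rfl⟩
    exact ⟨hp.reverse, by simpa using hl⟩
  · rintro ⟨hp, hl⟩
    exact ⟨q.reverse, ⟨hp.reverse, by simpa using hl⟩, by simp⟩

theorem encard_paths_le_of_embedding {W : Type*} {H : SimpleGraph W} (f : G ↪g H) (u v : V)
    (m : ℕ) : {q : G.Walk v u | q.IsPath ∧ q.length = m}.encard ≤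
      {q : H.Walk (f v) (f u) | q.IsPath ∧ q.length = m}.encard := by
  have hinj := Walk.map_injective_of_injective (f := f.toHom) f.injective v u
  rw [← hinj.encard_image]
  refine Set.encard_le_encard ?_
  rintro _ ⟨p, ⟨hp, hl⟩, rfl⟩
  exact ⟨hp.map f.injective, by simpa using hl⟩

theorem encard_paths_iso {W : Type*} {H : SimpleGraph W} (f : G ≃g H) (u v : V)
    (m : ℕ) : {q : G.Walk v u | q.IsPath ∧ q.length = m}.encard =
      {q : H.Walk (f v) (f u) | q.IsPath ∧ q.length = m}.encard := by
  refine le_antisymm (encard_paths_le_of_embedding f.toEmbedding u v m) ?_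
  have := encard_paths_le_of_embedding f.symm.toEmbedding (f u) (f v) m
  have cast : ∀ {a b : V}, a = u → b = v → {q : G.Walk b a | q.IsPath ∧ q.length = m}.encard =
      {q : G.Walk v u | q.IsPath ∧ q.length = m}.encard := by
    rintro _ _ rfl rfl
    rfl
  exact this.trans_eq (cast (f.symm_apply_apply u) (f.symm_apply_apply v))

theorem IsCycleRegular.of_iso {W : Type*} {H : SimpleGraph W} (f : G ≃g H) {r m : ℕ} (hm : 2 ≤ m)
    (hH : H.IsCycleRegular 1 r (m + 1)) : G.IsCycleRegular 1 r (m + 1) := by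
  rw [isCycleRegular_one_iff hm] at hH ⊢
  intro u v h
  rw [encard_paths_iso f u v m]
  exact hH _ _ (f.map_adj_iff.2 h)

end SimpleGraph

/-! ### Walks in `I`-graphs as words -/

/-- A layer (`true` for the inner one) together with a displacement `(x, y)`, which stands for
`x * j + y * k`. -/
abbrev LayerPos := Bool × ℤ × ℤ

namespace LayerPos

/-- Move along a spoke (letter `0`), forwards (letter `1`) or backwards (letter `2`). -/
def step : LayerPos → Fin 3 → LayerPos
  | (l, x, y), 0 => (!l, x, y)
  | (false, x, y), 1 => (false, x + 1, y)
  | (true, x, y), 1 => (true, x, y + 1)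
  | (false, x, y), 2 => (false, x - 1, y)
  | (true, x, y), 2 => (true, x, y - 1)

/-- The list of positions visited when spelling a word. -/
def trace : LayerPos → List (Fin 3) → List LayerPos
  | s, [] => [s]
  | s, a :: w => s :: trace (s.step a) w

/-- The final position after spelling a word. -/
def endpoint : LayerPos → List (Fin 3) → LayerPos
  | s, [] => s
  | s, a :: w => endpoint (s.step a) w

/-- The vertex of an `I`-graph at a given position relative to the base point `a`. -/
def toVertex (n j k : ℕ) (a : ZMod n) : LayerPos → ZMod n ⊕ ZMod n
  | (false, x, y) => Sum.inl (a + ((x * j + y * k : ℤ) : ZMod n))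
  | (true, x, y) => Sum.inr (a + ((x * j + y * k : ℤ) : ZMod n))

end LayerPos

/-- The displacements `(x, y)` with `x * j + y * k` divisible by `n`. -/
def relationLattice (n j k : ℕ) : AddSubgroup (ℤ × ℤ) where
  carrier := {d | (n : ℤ) ∣ d.1 * j + d.2 * k}
  add_mem' {p q} hp hq := by
    replace hp : (n : ℤ) ∣ p.1 * j + p.2 * k := hp
    replace hq : (n : ℤ) ∣ q.1 * j + q.2 * k := hq
    change (n : ℤ) ∣ (p.1 + q.1) * j + (p.2 + q.2) * k
    rw [show (p.1 + q.1) * (j : ℤ) + (p.2 + q.2) * k =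
      (p.1 * j + p.2 * k) + (q.1 * j + q.2 * k) by ring]
    exact dvd_add hp hq
  zero_mem' := by simp
  neg_mem' {p} hp := by
    replace hp : (n : ℤ) ∣ p.1 * j + p.2 * k := hp
    change (n : ℤ) ∣ -p.1 * j + -p.2 * k
    rw [show -p.1 * (j : ℤ) + -p.2 * k = -(p.1 * j + p.2 * k) by ring]
    exact (dvd_neg (a := (n : ℤ))).2 hp

theorem mem_relationLattice {n j k : ℕ} {d : ℤ × ℤ} :
    d ∈ relationLattice n j k ↔ (n : ℤ) ∣ d.1 * j + d.2 * k := Iff.rfl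

instance (n j k : ℕ) (d : ℤ × ℤ) : Decidable (d ∈ relationLattice n j k) :=
  decidable_of_iff _ mem_relationLattice.symm

theorem LayerPos.toVertex_eq_iff {n j k : ℕ} {a : ZMod n} {s t : LayerPos} :
    s.toVertex n j k a = t.toVertex n j k a ↔ s.1 = t.1 ∧ t.2 - s.2 ∈ relationLattice n j k := by
  obtain ⟨l, x, y⟩ := s
  obtain ⟨l', x', y'⟩ := t
  have key : (a + ((x * j + y * k : ℤ) : ZMod n) = a + ((x' * j + y' * k : ℤ) : ZMod n)) ↔
      (x', y') - (x, y) ∈ relationLattice n j k := by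
    rw [add_right_inj, ZMod.intCast_eq_intCast_iff_dvd_sub, mem_relationLattice]
    simp only [Prod.mk_sub_mk]
    ring_nf
  cases l <;> cases l' <;> simp [toVertex] <;> simpa using key

/-- No step along a layer has displacement zero or displacement of order two. -/
structure IGraphParams (n j k : ℕ) : Prop where
  hj : 1 ≤ j
  hk : 1 ≤ k
  hjn : 2 * j < n
  hkn : 2 * k < n

namespace IGraphParams

variable {n j k : ℕ} (h : IGraphParams n j k)

include h

theorem swap : IGraphParams n k j := ⟨h.hk, h.hj, h.hkn, h.hjn⟩

theorem not_dvd_j {c : ℤ} (hc : 0 < c) (hc' : c ≤ 2) : ¬ (n : ℤ) ∣ c * j := by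
  have := h.hj
  have := h.hjn
  intro hd
  have := Int.le_of_dvd (by positivity) hd
  nlinarith

theorem not_dvd_k {c : ℤ} (hc : 0 < c) (hc' : c ≤ 2) : ¬ (n : ℤ) ∣ c * k :=
  h.swap.not_dvd_j hc hc'

theorem notMem_lattice :
    ∀ d ∈ ([(1, 0), (2, 0), (0, 1), (0, 2)] : List (ℤ × ℤ)), d ∉ relationLattice n j k := by
  have h1 := h.not_dvd_j (c := 1) (by norm_num) (by norm_num)
  have h2 := h.not_dvd_j (c := 2) (by norm_num) (by norm_num)
  have h3 := h.not_dvd_k (c := 1) (by norm_num) (by norm_num)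
  have h4 := h.not_dvd_k (c := 2) (by norm_num) (by norm_num)
  simp only [List.forall_mem_cons, mem_relationLattice]
  simp_all

/-- The two neighbours along a layer differ by `2 * j` or `2 * k`, which is nonzero modulo `n` by
the strict bounds. The graph is therefore cubic, and distinct words spell distinct walks. -/
theorem step_injective (a : ZMod n) (s : LayerPos) {b c : Fin 3}
    (hbc : (s.step b).toVertex n j k a = (s.step c).toVertex n j k a) : b = c := by
  rw [LayerPos.toVertex_eq_iff] at hbc
  obtain ⟨l, x, y⟩ := s
  have h1 := h.not_dvd_j (c := 1) (by norm_num) (by norm_num)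
  have h2 := h.not_dvd_j (c := 2) (by norm_num) (by norm_num)
  have h3 := h.not_dvd_k (c := 1) (by norm_num) (by norm_num)
  have h4 := h.not_dvd_k (c := 2) (by norm_num) (by norm_num)
  by_contra hne
  have aux : ∀ x : ℤ, x - 1 - (x + 1) = -2 ∧ x + 1 - (x - 1) = 2 := fun x => by
    constructor <;> ring
  fin_cases b <;> fin_cases c <;> cases l <;>
    simp_all [LayerPos.step, mem_relationLattice]

theorem adj_toVertex_iff (a : ZMod n) (s : LayerPos) (v : ZMod n ⊕ ZMod n) :
    (iGraph n j k).Adj (s.toVertex n j k a) v ↔ ∃ b, v = (s.step b).toVertex n j k a := by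
  obtain ⟨l, x, y⟩ := s
  have hj : (j : ZMod n) ≠ 0 := fun h0 => h.not_dvd_j (c := 1) (by norm_num) (by norm_num) (by
    rw [one_mul]; exact_mod_cast (ZMod.natCast_eq_zero_iff j n).1 h0)
  have hk : (k : ZMod n) ≠ 0 := fun h0 => h.not_dvd_k (c := 1) (by norm_num) (by norm_num) (by
    rw [one_mul]; exact_mod_cast (ZMod.natCast_eq_zero_iff k n).1 h0)
  have fin3 : ∀ p : Fin 3 → Prop, (∃ b, p b) ↔ p 0 ∨ p 1 ∨ p 2 := fun p => by
    simp [Fin.exists_fin_succ]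
  rw [fin3]
  cases l <;> rcases v with v | v <;>
    simp only [iGraph, SimpleGraph.fromRel_adj, LayerPos.toVertex, LayerPos.step, Bool.not_false,
      Bool.not_true, ne_eq, Sum.inl.injEq, Sum.inr.injEq, reduceCtorEq, not_false_eq_true,
      true_and, false_or, or_false]
  · have e1 : a + (((x + 1) * j + y * k : ℤ) : ZMod n) =
        a + ((x * j + y * k : ℤ) : ZMod n) + j := by push_cast; ring
    have e2 : a + (((x - 1) * j + y * k : ℤ) : ZMod n) =
        a + ((x * j + y * k : ℤ) : ZMod n) - j := by push_cast; ring
    rw [e1, e2]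
    generalize a + ((x * j + y * k : ℤ) : ZMod n) = z
    constructor
    · rintro ⟨-, h | h⟩
      · exact Or.inl h
      · exact Or.inr (eq_sub_of_add_eq h.symm)
    · rintro (h | h)
      · subst h; simp [hj]
      · subst h; exact ⟨fun h0 => hj (sub_eq_self.1 h0.symm), Or.inr (by ring)⟩
  · exact eq_comm
  · have e1 : a + ((x * j + (y + 1) * k : ℤ) : ZMod n) =
        a + ((x * j + y * k : ℤ) : ZMod n) + k := by push_cast; ring
    have e2 : a + ((x * j + (y - 1) * k : ℤ) : ZMod n) =
        a + ((x * j + y * k : ℤ) : ZMod n) - k := by push_cast; ring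
    rw [e1, e2]
    generalize a + ((x * j + y * k : ℤ) : ZMod n) = z
    constructor
    · rintro ⟨-, h | h⟩
      · exact Or.inl h
      · exact Or.inr (eq_sub_of_add_eq h.symm)
    · rintro (h | h)
      · subst h; simp [hk]
      · subst h; exact ⟨fun h0 => hk (sub_eq_self.1 h0.symm), Or.inr (by ring)⟩

/-- Walks and words are matched through their lists of vertices, which avoids comparing walks whose
endpoints are only propositionally equal. -/
theorem exists_walk_iff (a : ZMod n) (t : ZMod n ⊕ ZMod n) (m : ℕ) (s : LayerPos)
    (l : List (ZMod n ⊕ ZMod n)) :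
    (∃ q : (iGraph n j k).Walk (s.toVertex n j k a) t, q.length = m ∧ q.support = l) ↔
      ∃ w : List (Fin 3), w.length = m ∧ (s.trace w).map (LayerPos.toVertex n j k a) = l ∧
        (s.endpoint w).toVertex n j k a = t := by
  induction m generalizing s l with
  | zero =>
    constructor
    · rintro ⟨q, hq, rfl⟩
      obtain rfl := SimpleGraph.Walk.eq_of_length_eq_zero hq
      rw [(SimpleGraph.Walk.length_eq_zero_iff.1 hq).eq_nil]
      exact ⟨[], rfl, rfl, rfl⟩
    · rintro ⟨w, hw, rfl, rfl⟩
      obtain rfl := List.length_eq_zero_iff.1 hw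
      exact ⟨SimpleGraph.Walk.nil, rfl, rfl⟩
  | succ m ih =>
    constructor
    · rintro ⟨q, hq, rfl⟩
      generalize hu : s.toVertex n j k a = u at q
      cases q with
      | nil => simp at hq
      | @cons _ v _ huv q =>
        subst hu
        obtain ⟨b, rfl⟩ := (h.adj_toVertex_iff a s v).1 huv
        obtain ⟨w, hw, hl, ht⟩ := (ih (s.step b) q.support).1 ⟨q, by simpa using hq, rfl⟩
        exact ⟨b :: w, by simp [hw], by simp [LayerPos.trace, hl], ht⟩
    · rintro ⟨w, hw, rfl, ht⟩
      cases w with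
      | nil => simp at hw
      | cons b w =>
        obtain ⟨q, hq, hl⟩ := (ih (s.step b) _).2 ⟨w, by simpa using hw, rfl, ht⟩
        exact ⟨SimpleGraph.Walk.cons ((h.adj_toVertex_iff a s _).2 ⟨b, rfl⟩) q, by simp [hq],
          by simp [LayerPos.trace, hl]⟩

theorem map_trace_injective (a : ZMod n) (s : LayerPos) :
    Function.Injective fun w => (s.trace w).map (LayerPos.toVertex n j k a) := by
  intro w w' hw
  induction w generalizing s w' with
  | nil =>
    cases w' with
    | nil => rfl
    | cons c w' => cases w' <;> simp [LayerPos.trace] at hw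
  | cons b w ih =>
    cases w' with
    | nil => cases w <;> simp [LayerPos.trace] at hw
    | cons c w' =>
      simp only [LayerPos.trace, List.map_cons, List.cons.injEq, true_and] at hw
      have hbc : b = c := by
        refine h.step_injective a s ?_
        have := congrArg List.head? hw
        cases w <;> cases w' <;> simpa [LayerPos.trace] using this
      subst hbc
      rw [ih (s.step b) hw]

theorem encard_paths_eq_encard_words (a : ZMod n) (s t : LayerPos) (m : ℕ) :
    {q : (iGraph n j k).Walk (s.toVertex n j k a) (t.toVertex n j k a) |
        q.IsPath ∧ q.length = m}.encard =
      {w : List (Fin 3) | w.length = m ∧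
        ((s.trace w).map (LayerPos.toVertex n j k a)).Nodup ∧
        (s.endpoint w).toVertex n j k a = t.toVertex n j k a}.encard := by
  have hinj : Function.Injective (fun q : (iGraph n j k).Walk (s.toVertex n j k a)
      (t.toVertex n j k a) => q.support) := fun p q hpq => SimpleGraph.Walk.ext_support hpq
  rw [← hinj.encard_image, ← (h.map_trace_injective a s).encard_image]
  congr 1
  ext l
  have key := h.exists_walk_iff a (t.toVertex n j k a) m s l
  constructor
  · rintro ⟨q, ⟨hq, hl⟩, rfl⟩
    obtain ⟨w, hw, hwl, ht⟩ := key.1 ⟨q, hl, rfl⟩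
    exact ⟨w, ⟨hw, by rw [hwl]; exact hq.support_nodup, ht⟩, hwl⟩
  · rintro ⟨w, ⟨hw, hn, ht⟩, rfl⟩
    obtain ⟨q, hq, hl⟩ := key.2 ⟨w, hw, rfl, ht⟩
    exact ⟨q, ⟨SimpleGraph.Walk.IsPath.mk' (by rw [hl]; exact hn), hq⟩, hl⟩

end IGraphParams

/-! ### Counting words -/

/-- The displacements between positions of the same layer in a list. -/
def layerDiffs : List LayerPos → List (ℤ × ℤ)
  | [] => []
  | s :: l => (l.filter fun t => s.1 = t.1).map (fun t => t.2 - s.2) ++ layerDiffs l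

/-- A cycle type: the displacement that has to vanish, and those that must not vanish. -/
abbrev CycleType := (ℤ × ℤ) × List (ℤ × ℤ)

/-- A lattice of relations realises a cycle type if it contains the closing displacement and avoids
the forbidden ones. -/
def CycleType.Realised (L : AddSubgroup (ℤ × ℤ)) (c : CycleType) : Prop :=
  c.1 ∈ L ∧ ∀ d ∈ c.2, d ∉ L

instance (L : AddSubgroup (ℤ × ℤ)) [DecidablePred (· ∈ L)] (c : CycleType) :
    Decidable (c.Realised L) :=
  inferInstanceAs (Decidable (c.1 ∈ L ∧ ∀ d ∈ c.2, d ∉ L))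

/-- The cycle type of a word leading from `s` to `t`. -/
def wordType (s t : LayerPos) (w : List (Fin 3)) : CycleType :=
  ((s.endpoint w).2 - t.2, layerDiffs (s.trace w))

theorem nodup_map_toVertex_iff {n j k : ℕ} (a : ZMod n) (l : List LayerPos) :
    (l.map (LayerPos.toVertex n j k a)).Nodup ↔
      ∀ d ∈ layerDiffs l, d ∉ relationLattice n j k := by
  induction l with
  | nil => simp [layerDiffs]
  | cons s l ih =>
    rw [List.map_cons, List.nodup_cons, ih, layerDiffs, List.forall_mem_append]
    refine and_congr_left fun _ => ?_
    simp only [List.mem_map, List.mem_filter, decide_eq_true_eq, not_exists, not_and]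
    constructor
    · rintro H _ ⟨t, ⟨ht, hl⟩, rfl⟩ hd
      exact H t ht (LayerPos.toVertex_eq_iff.2 ⟨hl, hd⟩).symm
    · intro H t ht heq
      obtain ⟨hl, hd⟩ := LayerPos.toVertex_eq_iff.1 heq.symm
      exact H _ ⟨t, ⟨ht, hl⟩, rfl⟩ hd

theorem nodup_and_endpoint_iff {n j k : ℕ} (a : ZMod n) (s t : LayerPos) (w : List (Fin 3)) :
    (((s.trace w).map (LayerPos.toVertex n j k a)).Nodup ∧
      (s.endpoint w).toVertex n j k a = t.toVertex n j k a) ↔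
      t.1 = (s.endpoint w).1 ∧ (wordType s t w).Realised (relationLattice n j k) := by
  rw [nodup_map_toVertex_iff, eq_comm, LayerPos.toVertex_eq_iff]
  unfold wordType CycleType.Realised
  tauto

/-! ### Comparing cycle types independently of the lattice -/

namespace CycleType

/-- Every displacement of `l` agrees, up to sign and up to a multiple of `r`, with one of `l'`. -/
def coveredBy (r : ℤ × ℤ) (l l' : List (ℤ × ℤ)) : Bool :=
  l.all fun d => l'.any fun e =>
    d - e == 0 || d - e == r || d - e == -r || d + e == 0 || d + e == r || d + e == -r

/-- A sufficient criterion for two cycle types to be realised by the same lattices. -/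
def equivalent (c c' : CycleType) : Bool :=
  (c.1 == c'.1 || c.1 == -c'.1) && coveredBy c.1 c.2 c'.2 && coveredBy c.1 c'.2 c.2

theorem notMem_of_coveredBy {L : AddSubgroup (ℤ × ℤ)} {r : ℤ × ℤ} (hr : r ∈ L)
    {l l' : List (ℤ × ℤ)} (h : coveredBy r l l' = true) (hl' : ∀ d ∈ l', d ∉ L) :
    ∀ d ∈ l, d ∉ L := by
  intro d hd hdL
  simp only [coveredBy, List.all_eq_true, List.any_eq_true, Bool.or_eq_true, beq_iff_eq] at h
  obtain ⟨e, he, h⟩ := h d hd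
  refine hl' e he ?_
  have hneg := L.neg_mem hr
  have key : d - e ∈ L ∨ d + e ∈ L := by
    rcases h with ((((h | h) | h) | h) | h) | h <;> rw [h]
    · exact Or.inl L.zero_mem
    · exact Or.inl hr
    · exact Or.inl hneg
    · exact Or.inr L.zero_mem
    · exact Or.inr hr
    · exact Or.inr hneg
  rcases key with key | key
  · simpa using L.sub_mem hdL key
  · simpa using L.sub_mem key hdL

theorem realised_iff_of_equivalent {L : AddSubgroup (ℤ × ℤ)} {c c' : CycleType}
    (h : equivalent c c' = true) : c.Realised L ↔ c'.Realised L := by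
  simp only [equivalent, Bool.and_eq_true, Bool.or_eq_true, beq_iff_eq] at h
  obtain ⟨⟨h1, h2⟩, h3⟩ := h
  have h4 : c.1 ∈ L ↔ c'.1 ∈ L := by
    rcases h1 with h1 | h1 <;> rw [h1]
    exact L.neg_mem_iff
  unfold Realised
  rw [← h4]
  exact and_congr_right fun hc => ⟨notMem_of_coveredBy hc h3, notMem_of_coveredBy hc h2⟩

/-- The cycle type cannot be realised: it forces two positions to coincide, or it forces an edge
displacement to have order at most two. -/
def impossible (c : CycleType) : Bool :=
  (c.2.any fun d => d == 0 || d == c.1 || d == -c.1) ||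
    ([(1, 0), (2, 0), (0, 1), (0, 2)] : List (ℤ × ℤ)).any fun d => c.1 == d || c.1 == -d

theorem not_realised_of_impossible {L : AddSubgroup (ℤ × ℤ)}
    (hL : ∀ d ∈ ([(1, 0), (2, 0), (0, 1), (0, 2)] : List (ℤ × ℤ)), d ∉ L) {c : CycleType}
    (h : impossible c = true) : ¬ c.Realised L := by
  rintro ⟨h1, h2⟩
  simp only [impossible, Bool.or_eq_true, beq_iff_eq, List.any_eq_true] at h
  rcases h with ⟨d, hd, h⟩ | ⟨d, hd, h⟩
  · refine h2 d hd ?_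
    rcases h with (h | h) | h <;> rw [h]
    · exact L.zero_mem
    · exact h1
    · exact L.neg_mem h1
  · refine hL d hd ?_
    rcases h with h | h <;> rw [h] at h1
    · exact h1
    · exact L.neg_mem_iff.1 h1

end CycleType

/-! ### Certifying a classification by enumeration -/

/-- All words of a given length. -/
def allWords : ℕ → List (List (Fin 3))
  | 0 => [[]]
  | m + 1 => (allWords m).flatMap fun w => [0 :: w, 1 :: w, 2 :: w]

theorem mem_allWords {m : ℕ} {w : List (Fin 3)} : w ∈ allWords m ↔ w.length = m := by
  induction m generalizing w with
  | zero => simp [allWords]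
  | succ m ih =>
    simp only [allWords, List.mem_flatMap, ih]
    cases w with
    | nil => simp
    | cons b w => fin_cases b <;> simp

/-- A list of words with their cycle types contains all words of length `m` from `s` to `t` that
can be paths. -/
def isClassification (s t : LayerPos) (m : ℕ) (l : List (List (Fin 3) × CycleType)) : Bool :=
  ((allWords m).all fun w => t.1 != (s.endpoint w).1 ||
      (l.map Prod.fst).contains w || (wordType s t w).impossible) &&
    (l.all fun p => p.1.length == m && t.1 == (s.endpoint p.1).1 &&
      (wordType s t p.1).equivalent p.2) && decide (l.map Prod.fst).Nodup

/-- Words outside the list end on the wrong layer or have an impossible type, and the listed words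
are distinct. The paths are therefore the listed words whose type is realised, and each type may be
replaced by its equivalent normal form. -/
theorem IGraphParams.encard_paths_of_isClassification {n j k : ℕ} (h : IGraphParams n j k)
    (a : ZMod n) {s t : LayerPos} {m : ℕ} {l : List (List (Fin 3) × CycleType)}
    (hl : isClassification s t m l = true) :
    {q : (iGraph n j k).Walk (s.toVertex n j k a) (t.toVertex n j k a) |
        q.IsPath ∧ q.length = m}.encard =
      ((l.map Prod.snd).countP fun c => c.Realised (relationLattice n j k) : ℕ) := by
  rw [h.encard_paths_eq_encard_words]
  simp only [isClassification, Bool.and_eq_true, List.all_eq_true, Bool.or_eq_true, bne_iff_ne,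
    beq_iff_eq, List.contains_iff_mem, decide_eq_true_eq, mem_allWords] at hl
  obtain ⟨⟨hall, hshape⟩, hnodup⟩ := hl
  set L := relationLattice n j k with hL
  have hset : {w : List (Fin 3) | w.length = m ∧
        ((s.trace w).map (LayerPos.toVertex n j k a)).Nodup ∧
        (s.endpoint w).toVertex n j k a = t.toVertex n j k a} =
      (((l.filter fun p => p.2.Realised L).map Prod.fst).toFinset : Set (List (Fin 3))) := by
    ext w
    simp only [nodup_and_endpoint_iff, Set.mem_ofPred_eq, List.coe_toFinset, List.mem_map,
      List.mem_filter, decide_eq_true_eq]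
    constructor
    · rintro ⟨hw, hlay, hr⟩
      rcases hall w hw with (h' | h') | h'
      · exact absurd hlay h'
      · obtain ⟨p, hp, rfl⟩ := List.mem_map.1 h'
        exact ⟨p, ⟨hp, (CycleType.realised_iff_of_equivalent (hshape p hp).2).1 hr⟩, rfl⟩
      · exact absurd hr (CycleType.not_realised_of_impossible h.notMem_lattice h')
    · rintro ⟨p, ⟨hp, hr⟩, rfl⟩
      obtain ⟨⟨h1, h2⟩, h3⟩ := hshape p hp
      exact ⟨h1, h2, (CycleType.realised_iff_of_equivalent h3).2 hr⟩
  rw [hset, Set.encard_coe_eq_coe_finsetCard, List.toFinset_card_of_nodup, List.length_map,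
    List.countP_map, List.countP_eq_length_filter]
  · rfl
  · exact (List.Sublist.map _ List.filter_sublist).nodup hnodup

/-! ### The cycles of length eight -/

namespace CycleType

/-- The eight-cycles with two spokes, `p` outer edges and `q` inner edges. The sign `e = ±1` tells
whether the outer and the inner part go in opposite directions around the cycle. -/
def twoSpokes (p q : ℕ) (e : ℤ) : CycleType :=
  ((p, e * q), (List.range p).map (fun i => ((i : ℤ) + 1, 0)) ++
    (List.range q).map (fun i => (0, (i : ℤ) + 1)))

/-- The eight-cycles consisting of outer edges. -/
def allOuter : CycleType :=
  ((8, 0), (List.range 7).map fun i => ((i : ℤ) + 1, 0))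

/-- The eight-cycles consisting of inner edges. -/
def allInner : CycleType :=
  ((0, 8), (List.range 7).map fun i => (0, (i : ℤ) + 1))

/-- The eight-cycles with four spokes, where the two outer edges are traversed in opposite
directions, as are the two inner ones. -/
def fourSpokes : CycleType := ((0, 0), [(1, 0), (0, 1), (1, 1), (1, -1)])

/-- The eight-cycles with four spokes, where the two outer edges are traversed in the same
direction, as are the two inner ones. -/
def fourSpokesTwisted (e : ℤ) : CycleType := ((2, 2 * e), [(1, 0), (0, 1), (1, e)])

end CycleType

open CycleType

/-- The letters and their signs, for steps along a layer. -/
def signedLetters : List (Fin 3 × ℤ) := [(1, 1), (2, -1)]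

/-- The words that go on from one forward step along a layer to a cycle with two spokes, having
`p` edges on that layer and `q` on the other one. -/
def twoSpokesLayerWords (p q : ℕ) (x : Fin 3) : List (List (Fin 3)) :=
  (List.range p).map fun i =>
    List.replicate i 1 ++ 0 :: (List.replicate q x ++ 0 :: List.replicate (p - 1 - i) 1)

/-- The words that close up an outer edge. -/
def outerClassification : List (List (Fin 3) × CycleType) :=
  (List.replicate 7 1, allOuter) ::
    ((List.range 5).flatMap fun i => signedLetters.flatMap fun x =>
      (twoSpokesLayerWords (i + 1) (5 - i) x.1).map fun w =>
        (w, twoSpokes (i + 1) (5 - i) x.2)) ++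
    [([0, 1, 0, 2, 0, 2, 0], fourSpokes), ([0, 2, 0, 2, 0, 1, 0], fourSpokes),
      ([0, 1, 0, 1, 0, 1, 0], fourSpokesTwisted 1), ([0, 2, 0, 1, 0, 2, 0], fourSpokesTwisted (-1))]

/-- The words that close up an inner edge. -/
def innerClassification : List (List (Fin 3) × CycleType) :=
  (List.replicate 7 1, allInner) ::
    ((List.range 5).flatMap fun i => signedLetters.flatMap fun x =>
      (twoSpokesLayerWords (5 - i) (i + 1) x.1).map fun w =>
        (w, twoSpokes (i + 1) (5 - i) x.2)) ++
    [([0, 1, 0, 2, 0, 2, 0], fourSpokes), ([0, 2, 0, 2, 0, 1, 0], fourSpokes),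
      ([0, 1, 0, 1, 0, 1, 0], fourSpokesTwisted 1), ([0, 2, 0, 1, 0, 2, 0], fourSpokesTwisted (-1))]

/-- The words that close up a spoke. -/
def spokeClassification : List (List (Fin 3) × CycleType) :=
  ((List.range 5).flatMap fun i => signedLetters.flatMap fun x => signedLetters.map fun y =>
    (List.replicate (5 - i) y.1 ++ 0 :: List.replicate (i + 1) (if x.2 = y.2 then 1 else 2),
      twoSpokes (i + 1) (5 - i) x.2)) ++
    [([1, 0, 1, 0, 2, 0, 2], fourSpokes), ([1, 0, 2, 0, 2, 0, 1], fourSpokes),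
      ([2, 0, 1, 0, 1, 0, 2], fourSpokes), ([2, 0, 2, 0, 1, 0, 1], fourSpokes),
      ([1, 0, 1, 0, 1, 0, 1], fourSpokesTwisted 1), ([2, 0, 2, 0, 2, 0, 2], fourSpokesTwisted 1),
      ([1, 0, 2, 0, 1, 0, 2], fourSpokesTwisted (-1)),
      ([2, 0, 1, 0, 2, 0, 1], fourSpokesTwisted (-1))]

/-- The words start at the far end of the edge, as if the first of the eight steps had been made.
The difference between final position and target is thus the total displacement of the cycle. -/
theorem isClassification_outer :
    isClassification (false, 1, 0) (false, 0, 0) 7 outerClassification = true := by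
  decide +kernel

theorem isClassification_inner :
    isClassification (true, 0, 1) (true, 0, 0) 7 innerClassification = true := by
  decide +kernel

theorem isClassification_spoke :
    isClassification (true, 0, 0) (false, 0, 0) 7 spokeClassification = true := by
  decide +kernel

/-! ### Weighted cycle counts for the three kinds of edges -/

/-- The indicator of the realisation of a cycle type. -/
def CycleType.indicator (n j k : ℕ) (c : CycleType) : ℕ :=
  if c.Realised (relationLattice n j k) then 1 else 0

theorem countP_replicate_realised (n j k m : ℕ) (c : CycleType) :
    (List.replicate m c).countP (fun c => c.Realised (relationLattice n j k)) =
      m * c.indicator n j k := by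
  rw [List.countP_replicate, indicator]
  simp

/-- The number of eight-cycles through an outer edge. -/
def outerCount (n j k : ℕ) : ℕ :=
  allOuter.indicator n j k +
    ((List.range 5).map fun i => (i + 1) * ((twoSpokes (i + 1) (5 - i) 1).indicator n j k +
      (twoSpokes (i + 1) (5 - i) (-1)).indicator n j k)).sum +
    (2 * fourSpokes.indicator n j k +
      ((fourSpokesTwisted 1).indicator n j k + (fourSpokesTwisted (-1)).indicator n j k))

/-- The number of eight-cycles through an inner edge. -/
def innerCount (n j k : ℕ) : ℕ :=
  allInner.indicator n j k +
    ((List.range 5).map fun i => (5 - i) * ((twoSpokes (i + 1) (5 - i) 1).indicator n j k +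
      (twoSpokes (i + 1) (5 - i) (-1)).indicator n j k)).sum +
    (2 * fourSpokes.indicator n j k +
      ((fourSpokesTwisted 1).indicator n j k + (fourSpokesTwisted (-1)).indicator n j k))

/-- The number of eight-cycles through a spoke. -/
def spokeCount (n j k : ℕ) : ℕ :=
  ((List.range 5).map fun i => 2 * ((twoSpokes (i + 1) (5 - i) 1).indicator n j k +
      (twoSpokes (i + 1) (5 - i) (-1)).indicator n j k)).sum +
    (4 * fourSpokes.indicator n j k +
      (2 * (fourSpokesTwisted 1).indicator n j k + 2 * (fourSpokesTwisted (-1)).indicator n j k))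

theorem countP_outerClassification (n j k : ℕ) :
    (outerClassification.map Prod.snd).countP
      (fun c => c.Realised (relationLattice n j k)) = outerCount n j k := by
  have : outerClassification.map Prod.snd = List.replicate 1 allOuter ++
      (((List.range 5).flatMap fun i => List.replicate (i + 1) (twoSpokes (i + 1) (5 - i) 1) ++
        List.replicate (i + 1) (twoSpokes (i + 1) (5 - i) (-1))) ++
      (List.replicate 2 fourSpokes ++ (List.replicate 1 (fourSpokesTwisted 1) ++
        List.replicate 1 (fourSpokesTwisted (-1))))) := by decide +kernel
  rw [this]
  simp only [List.countP_append, List.countP_flatMap, countP_replicate_realised, outerCount,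
    Function.comp_def, one_mul, mul_add, add_assoc]

theorem countP_innerClassification (n j k : ℕ) :
    (innerClassification.map Prod.snd).countP
      (fun c => c.Realised (relationLattice n j k)) = innerCount n j k := by
  have : innerClassification.map Prod.snd = List.replicate 1 allInner ++
      (((List.range 5).flatMap fun i => List.replicate (5 - i) (twoSpokes (i + 1) (5 - i) 1) ++
        List.replicate (5 - i) (twoSpokes (i + 1) (5 - i) (-1))) ++
      (List.replicate 2 fourSpokes ++ (List.replicate 1 (fourSpokesTwisted 1) ++
        List.replicate 1 (fourSpokesTwisted (-1))))) := by decide +kernel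
  rw [this]
  simp only [List.countP_append, List.countP_flatMap, countP_replicate_realised, innerCount,
    Function.comp_def, one_mul, mul_add, add_assoc]

theorem countP_spokeClassification (n j k : ℕ) :
    (spokeClassification.map Prod.snd).countP
      (fun c => c.Realised (relationLattice n j k)) = spokeCount n j k := by
  have : spokeClassification.map Prod.snd =
      ((List.range 5).flatMap fun i => List.replicate 2 (twoSpokes (i + 1) (5 - i) 1) ++
        List.replicate 2 (twoSpokes (i + 1) (5 - i) (-1))) ++
      (List.replicate 4 fourSpokes ++ (List.replicate 2 (fourSpokesTwisted 1) ++
        List.replicate 2 (fourSpokesTwisted (-1)))) := by decide +kernel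
  rw [this]
  simp only [List.countP_append, List.countP_flatMap, countP_replicate_realised, spokeCount,
    Function.comp_def, mul_add]

namespace IGraphParams

variable {n j k : ℕ} (h : IGraphParams n j k)

include h

/-- Translations act transitively on the outer edges, on the inner edges and on the spokes; the free
base point `a` plays their part, so one edge of each kind suffices. -/
theorem isCycleRegular_iff (r : ℕ) : (iGraph n j k).IsCycleRegular 1 r 8 ↔
    outerCount n j k = r ∧ innerCount n j k = r ∧ spokeCount n j k = r := by
  have ho := fun a => h.encard_paths_of_isClassification a isClassification_outer
  have hi := fun a => h.encard_paths_of_isClassification a isClassification_inner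
  have hs := fun a => h.encard_paths_of_isClassification a isClassification_spoke
  simp only [countP_outerClassification] at ho
  simp only [countP_innerClassification] at hi
  simp only [countP_spokeClassification] at hs
  rw [SimpleGraph.isCycleRegular_one_iff (by norm_num)]
  have hstep := fun (a : ZMod n) (s : LayerPos) (b : Fin 3) =>
    (h.adj_toVertex_iff a s _).2 ⟨b, rfl⟩
  constructor
  · intro H
    refine ⟨?_, ?_, ?_⟩
    · have := H _ _ (hstep 0 (false, 0, 0) 1)
      exact_mod_cast (ho 0).symm.trans this
    · have := H _ _ (hstep 0 (true, 0, 0) 1)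
      exact_mod_cast (hi 0).symm.trans this
    · have := H _ _ (hstep 0 (false, 0, 0) 0)
      exact_mod_cast (hs 0).symm.trans this
  · rintro ⟨ro, ri, rs⟩
    -- The classifications fix an orientation of each edge; the opposite one follows by reversing
    -- paths.
    have sym : ∀ {u v : ZMod n ⊕ ZMod n},
        {q : (iGraph n j k).Walk u v | q.IsPath ∧ q.length = 7}.encard = r →
        {q : (iGraph n j k).Walk v u | q.IsPath ∧ q.length = 7}.encard = r :=
      fun hr => (SimpleGraph.encard_paths_symm _ _ _).trans hr
    rw [ro] at ho
    rw [ri] at hi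
    rw [rs] at hs
    have cast : ∀ {u v u' v' : ZMod n ⊕ ZMod n}, u = u' → v = v' →
        {q : (iGraph n j k).Walk u v | q.IsPath ∧ q.length = 7}.encard = r →
        {q : (iGraph n j k).Walk u' v' | q.IsPath ∧ q.length = 7}.encard = r := by
      rintro _ _ _ _ rfl rfl hr
      exact hr
    replace ho := fun a => cast (u' := Sum.inl (a + (j : ZMod n))) (v' := Sum.inl a)
      (by simp [LayerPos.toVertex]) (by simp [LayerPos.toVertex]) (ho a)
    replace hi := fun a => cast (u' := Sum.inr (a + (k : ZMod n))) (v' := Sum.inr a)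
      (by simp [LayerPos.toVertex]) (by simp [LayerPos.toVertex]) (hi a)
    replace hs := fun a => cast (u' := Sum.inr a) (v' := Sum.inl a)
      (by simp [LayerPos.toVertex]) (by simp [LayerPos.toVertex]) (hs a)
    intro u v huv
    simp only [iGraph, SimpleGraph.fromRel_adj] at huv
    rcases u with u | u <;> rcases v with v | v <;> simp only [or_false, false_or] at huv <;>
      obtain ⟨-, huv⟩ := huv
    · rcases huv with rfl | rfl
      · exact ho u
      · exact sym (ho v)
    · subst huv
      exact hs v
    · subst huv
      exact sym (hs _)
    · rcases huv with rfl | rfl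
      · exact hi u
      · exact sym (hi v)

end IGraphParams

/-! ### Solving the counting equations -/

theorem CycleType.indicator_le_one (n j k : ℕ) (c : CycleType) : c.indicator n j k ≤ 1 := by
  unfold indicator
  split_ifs <;> omega

theorem CycleType.realised_of_indicator_ne_zero {n j k : ℕ} {c : CycleType}
    (h : c.indicator n j k ≠ 0) : c.Realised (relationLattice n j k) := by
  unfold indicator at h
  by_contra hc
  simp [hc] at h

/-- By Cramer's rule, the determinant times `j` and the determinant times `k` are both multiples of
`n`; coprimality then removes `gcd(j, k)`. -/
theorem dvd_det_of_mem_relationLattice {n j k : ℕ} (hgcd : Nat.gcd n (Nat.gcd j k) = 1)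
    {d e : ℤ × ℤ} (hd : d ∈ relationLattice n j k) (he : e ∈ relationLattice n j k) :
    (n : ℤ) ∣ d.1 * e.2 - e.1 * d.2 := by
  rw [mem_relationLattice] at hd he
  set D := d.1 * e.2 - e.1 * d.2
  have hj : (n : ℤ) ∣ D * j := by
    rw [show D * j = (d.1 * j + d.2 * k) * e.2 - (e.1 * j + e.2 * k) * d.2 by ring]
    exact dvd_sub (hd.mul_right _) (he.mul_right _)
  have hk : (n : ℤ) ∣ D * k := by
    rw [show D * k = (e.1 * j + e.2 * k) * d.1 - (d.1 * j + d.2 * k) * e.1 by ring]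
    exact dvd_sub (he.mul_right _) (hd.mul_right _)
  have hjk : (n : ℤ) ∣ D * (Nat.gcd j k : ℕ) := by
    rw [Nat.gcd_eq_gcd_ab, mul_add]
    rw [← mul_assoc, ← mul_assoc]
    exact dvd_add (hj.mul_right _) (hk.mul_right _)
  refine IsCoprime.dvd_of_dvd_mul_right ?_ hjk
  exact Nat.isCoprime_iff_coprime.2 hgcd

/-- Two realised types would give a nonzero determinant divisible by `n` but at most `b < n` in
absolute value. -/
theorem sum_indicator_le_one {n j k b : ℕ} (hgcd : Nat.gcd n (Nat.gcd j k) = 1) (hb : b < n)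
    {l : List CycleType}
    (hl : l.Pairwise fun c c' => c.1.1 * c'.1.2 - c'.1.1 * c.1.2 ≠ 0 ∧
      |c.1.1 * c'.1.2 - c'.1.1 * c.1.2| ≤ (b : ℤ)) :
    (l.map (CycleType.indicator n j k)).sum ≤ 1 := by
  induction l with
  | nil => simp
  | cons c l ih =>
    rw [List.pairwise_cons] at hl
    rw [List.map_cons, List.sum_cons]
    by_cases hc : c.indicator n j k = 0
    · rw [hc, zero_add]
      exact ih hl.2
    · have : (l.map (CycleType.indicator n j k)).sum = 0 := by
        rw [List.sum_eq_zero_iff]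
        simp only [List.mem_map]
        rintro _ ⟨c', hc', rfl⟩
        by_contra hne
        obtain ⟨h0, h1⟩ := hl.1 c' hc'
        have hdvd := dvd_det_of_mem_relationLattice hgcd (realised_of_indicator_ne_zero hc).1
          (realised_of_indicator_ne_zero hne).1
        have := Int.le_of_dvd (abs_pos.2 h0) ((dvd_abs _ _).2 hdvd)
        omega
      rw [this]
      exact indicator_le_one n j k c

theorem sum_indicator_twoSpokes_le_one {n j k : ℕ} (hgcd : Nat.gcd n (Nat.gcd j k) = 1)
    (hn : 26 < n) :
    ((List.range 5).map fun i => (twoSpokes (i + 1) (5 - i) 1).indicator n j k +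
      (twoSpokes (i + 1) (5 - i) (-1)).indicator n j k).sum ≤ 1 := by
  -- The largest determinant, 26, comes from `(1, 5)` and `(5, -1)`; both displacements vanish for
  -- `(n, j, k) = (26, 1, 5)`.
  have := sum_indicator_le_one hgcd hn (l := (List.range 5).flatMap fun i =>
    [twoSpokes (i + 1) (5 - i) 1, twoSpokes (i + 1) (5 - i) (-1)]) (by decide +kernel)
  simpa [List.range_succ, add_assoc] using this

namespace IGraphParams

variable {n j k : ℕ} (h : IGraphParams n j k)

include h

/-- The closing displacement is zero, so only a forbidden coincidence can fail the type. As `0 < j +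
k < n`, the only possible one is `j - k` vanishing modulo `n`. -/
theorem eq_of_indicator_fourSpokes_eq_zero (h0 : fourSpokes.indicator n j k = 0) : j = k := by
  by_contra hne
  have hr : fourSpokes.Realised (relationLattice n j k) := by
    refine ⟨AddSubgroup.zero_mem _, ?_⟩
    have h1 := h.notMem_lattice (1, 0) (by simp)
    have h2 := h.notMem_lattice (0, 1) (by simp)
    have := h.hj
    have := h.hk
    have := h.hjn
    have := h.hkn
    simp only [fourSpokes, List.forall_mem_cons]
    refine ⟨h1, h2, ?_, ?_, by simp⟩
    · rw [mem_relationLattice]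
      intro hd
      have := Int.le_of_dvd (by omega) hd
      omega
    · rw [mem_relationLattice]
      intro hd
      have := Int.eq_zero_of_abs_lt_dvd hd (by rw [abs_lt]; constructor <;> push_cast <;> omega)
      omega
  simp [indicator, hr] at h0

/-- Closing up requires `n ∣ 2 * (j - k)`; since `|2 * (j - k)| < n`, this forces `j = k`, which
collapses the cycle. -/
theorem indicator_fourSpokesTwisted_neg : (fourSpokesTwisted (-1)).indicator n j k = 0 := by
  by_contra hne
  obtain ⟨h1, h2⟩ := realised_of_indicator_ne_zero hne
  refine h2 (1, -1) (by simp [fourSpokesTwisted]) ?_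
  rw [mem_relationLattice]
  simp only [fourSpokesTwisted, mem_relationLattice] at h1
  have := h.hj
  have := h.hk
  have := h.hjn
  have := h.hkn
  have := Int.eq_zero_of_abs_lt_dvd h1 (by rw [abs_lt]; constructor <;> omega)
  have : (j : ℤ) = k := by omega
  simp [this]

theorem le_of_counts_eq (hgcd : Nat.gcd n (Nat.gcd j k) = 1)
    (h1 : outerCount n j k = spokeCount n j k) (h2 : innerCount n j k = spokeCount n j k) :
    n ≤ 26 := by
  by_contra! hn
  have hsum := sum_indicator_twoSpokes_le_one hgcd hn
  have hneg := h.indicator_fourSpokesTwisted_neg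
  have hD := indicator_le_one n j k fourSpokes
  have hA := indicator_le_one n j k allOuter
  have hB := indicator_le_one n j k allInner
  -- Both types together would give `n ∣ 8 * gcd(j, k)`, hence `n ∣ 8`.
  have hAB : allOuter.indicator n j k = 0 ∨ allInner.indicator n j k = 0 := by
    by_contra! hne
    have hj := (realised_of_indicator_ne_zero hne.1).1
    have hk := (realised_of_indicator_ne_zero hne.2).1
    simp only [allOuter, allInner, mem_relationLattice, zero_mul, add_zero, zero_add] at hj hk
    have hjk : n ∣ 8 * Nat.gcd j k := by
      rw [← Nat.gcd_mul_left]
      exact Nat.dvd_gcd (by exact_mod_cast hj) (by exact_mod_cast hk)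
    have := Nat.le_of_dvd (by norm_num) (Nat.Coprime.dvd_of_dvd_mul_right hgcd hjk)
    omega
  by_cases hjk : fourSpokes.indicator n j k = 0
  · have hjk' := h.eq_of_indicator_fourSpokes_eq_zero hjk
    -- For `j = k` the vector `(1, -1)` lies in `L`, so small determinants against it rule out the
    -- other types. The type with three edges on each layer and displacement `(3, -3)` does occur.
    subst hjk'
    have hmem : ((1, -1) : ℤ × ℤ) ∈ relationLattice n j j := by simp [mem_relationLattice]
    have hx : (twoSpokes (2 + 1) (5 - 2) (-1)).indicator n j j = 1 := by
      refine if_pos ⟨?_, ?_⟩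
      · simp [twoSpokes, mem_relationLattice]
      · intro d hd hdL
        have := dvd_det_of_mem_relationLattice hgcd hdL hmem
        simp [twoSpokes, List.range_succ] at hd
        rcases hd with rfl | rfl | rfl | rfl | rfl | rfl <;>
        · have := Int.le_of_dvd (by norm_num) ((dvd_abs _ _).2 this)
          norm_num at this
          omega
    have hE : (fourSpokesTwisted 1).indicator n j j = 0 := by
      by_contra hne
      have := dvd_det_of_mem_relationLattice hgcd (realised_of_indicator_ne_zero hne).1 hmem
      have := Int.le_of_dvd (by simp [fourSpokesTwisted]) ((dvd_abs _ _).2 this)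
      simp [fourSpokesTwisted] at this
      omega
    have hO : allOuter.indicator n j j = 0 := by
      by_contra hne
      have := dvd_det_of_mem_relationLattice hgcd (realised_of_indicator_ne_zero hne).1 hmem
      have := Int.le_of_dvd (by simp [allOuter]) ((dvd_abs _ _).2 this)
      simp [allOuter] at this
      omega
    -- Only the `(3, -3)` type remains: it contributes 3 to an outer edge but 2 to a spoke.
    simp [outerCount, spokeCount, List.range_succ] at h1 hsum hx
    omega
  -- Let `A`, `B`, `E`, `x` count the realised all-outer, all-inner, twisted and two-spoke types. As
  -- each two-spoke type has outer and inner weights summing to 6, adding the two equations gives `A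
  -- + B + 2 * x = 4 + 2 * E`, while the left side is at most 3.
  · simp [outerCount, innerCount, spokeCount, List.range_succ] at h1 h2 hsum
    omega

end IGraphParams

/-! ### The exceptional parameters -/

theorem iGraph_adj_inl_inl {n j k : ℕ} {a b : ZMod n} :
    (iGraph n j k).Adj (Sum.inl a) (Sum.inl b) ↔
      a ≠ b ∧ (b = a + (j : ZMod n) ∨ a = b + (j : ZMod n)) := by
  simp [iGraph, SimpleGraph.fromRel_adj]

theorem iGraph_adj_inr_inr {n j k : ℕ} {a b : ZMod n} :
    (iGraph n j k).Adj (Sum.inr a) (Sum.inr b) ↔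
      a ≠ b ∧ (b = a + (k : ZMod n) ∨ a = b + (k : ZMod n)) := by
  simp [iGraph, SimpleGraph.fromRel_adj]

theorem iGraph_adj_inl_inr {n j k : ℕ} {a b : ZMod n} :
    (iGraph n j k).Adj (Sum.inl a) (Sum.inr b) ↔ b = a := by
  simp [iGraph, SimpleGraph.fromRel_adj]

theorem iGraph_adj_inr_inl {n j k : ℕ} {a b : ZMod n} :
    (iGraph n j k).Adj (Sum.inr a) (Sum.inl b) ↔ a = b := by
  simp [iGraph, SimpleGraph.fromRel_adj]

/-- Exchanging the two layers. -/
def iGraphSwap (n j k : ℕ) : iGraph n j k ≃g iGraph n k j where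
  toEquiv := Equiv.sumComm _ _
  map_rel_iff' := by
    rintro (a | a) (b | b) <;>
      simp [iGraph_adj_inl_inl, iGraph_adj_inr_inr, iGraph_adj_inl_inr, iGraph_adj_inr_inl, eq_comm]

theorem units_mul_eq_add_iff {R : Type*} [CommRing R] (u : Rˣ) {x y : R}
    (h : u * x = y ∨ u * x = -y) (a b : R) :
    ((u : R) * b = u * a + y ∨ (u : R) * a = u * b + y) ↔ (b = a + x ∨ a = b + x) := by
  have cancel : ∀ c d : R, (u : R) * c = u * d ↔ c = d := fun c d => u.mul_right_inj
  rcases h with h | h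
  · rw [← h, ← mul_add, ← mul_add, cancel, cancel]
  · rw [show y = u * -x by rw [mul_neg, h, neg_neg], ← mul_add, ← mul_add, cancel, cancel, or_comm]
    refine or_congr ?_ ?_ <;> constructor <;> intro h' <;> rw [h'] <;> ring

/-- Multiplying all indices by a unit. -/
def iGraphMulUnit {n j k j' k' : ℕ} (u : (ZMod n)ˣ)
    (hj : (u : ZMod n) * j = j' ∨ (u : ZMod n) * j = -j')
    (hk : (u : ZMod n) * k = k' ∨ (u : ZMod n) * k = -k') : iGraph n j k ≃g iGraph n j' k' where
  toEquiv := Equiv.sumCongr u.mulLeft u.mulLeft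
  map_rel_iff' := by
    have cancel : ∀ c d : ZMod n, (u : ZMod n) * c = u * d ↔ c = d := fun c d => u.mul_right_inj
    rintro (a | a) (b | b) <;>
      simp [iGraph_adj_inl_inl, iGraph_adj_inr_inr, iGraph_adj_inl_inr, iGraph_adj_inr_inl, cancel,
        units_mul_eq_add_iff u hj, units_mul_eq_add_iff u hk]

/-- The parameters of the generalized Petersen graphs that are cycle regular for eight-cycles. -/
def exceptionalParams : List (ℕ × ℕ) :=
  [(3, 1), (4, 1), (5, 2), (8, 3), (10, 2), (10, 3), (12, 5), (13, 5), (24, 5), (26, 5)]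

/-- Some multiplier takes `(j, k)` to `(1, ± k')` modulo `n`. -/
def isMultiple (n j k k' : ℕ) : Bool :=
  (List.range n).any fun m => m * j % n == 1 && (m * k % n == k' || (m * k + k') % n == 0)

theorem nonempty_iso_of_isMultiple {n j k k' : ℕ} (hn : 1 < n)
    (h : isMultiple n j k k' = true) : Nonempty (iGraph n j k ≃g generalizedPetersen n k') := by
  simp only [isMultiple, List.any_eq_true, Bool.and_eq_true, Bool.or_eq_true, beq_iff_eq] at h
  obtain ⟨m, -, h1, h2⟩ := h
  have hmj : (m : ZMod n) * j = 1 := by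
    rw [← Nat.cast_one, ← Nat.cast_mul, ZMod.natCast_eq_natCast_iff]
    rw [Nat.ModEq, h1, Nat.mod_eq_of_lt hn]
  have hmk : (m : ZMod n) * k = k' ∨ (m : ZMod n) * k = -k' := by
    rcases h2 with h2 | h2
    · left
      rw [← Nat.cast_mul, ← h2, ZMod.natCast_mod]
    · right
      rw [eq_neg_iff_add_eq_zero, ← Nat.cast_mul, ← Nat.cast_add, ZMod.natCast_eq_zero_iff]
      exact Nat.dvd_of_mod_eq_zero h2
  exact ⟨iGraphMulUnit (Units.mkOfMulEqOne _ _ hmj) (Or.inl (by simpa using hmj)) hmk⟩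

/-- If the parameters are admissible and the three counts agree, then `I(n, j, k)` is isomorphic to
an exceptional generalized Petersen graph via a multiplier. -/
def IsMultipleOfCountsEq (n j k : ℕ) : Prop :=
  (1 ≤ j ∧ 1 ≤ k ∧ 2 * j < n ∧ 2 * k < n) → Nat.gcd n (Nat.gcd j k) = 1 →
    outerCount n j k = spokeCount n j k → innerCount n j k = spokeCount n j k →
      ∃ p ∈ exceptionalParams, p.1 = n ∧
        (isMultiple n j k p.2 = true ∨ isMultiple n k j p.2 = true)

instance (n j k : ℕ) : Decidable (IsMultipleOfCountsEq n j k) := by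
  unfold IsMultipleOfCountsEq
  infer_instance

/-- The counts are decidable through divisibility in the lattice, so the range left open by the
determinant bound is checked exhaustively. -/
theorem isMultipleOfCountsEq_of_lt :
    ∀ n < 27, ∀ j < n, ∀ k < n, IsMultipleOfCountsEq n j k := by
  decide +kernel

theorem exceptionalParams_counts : ∀ p ∈ exceptionalParams,
    (1 ≤ p.2 ∧ 2 * 1 < p.1 ∧ 2 * p.2 < p.1) ∧ outerCount p.1 1 p.2 = spokeCount p.1 1 p.2 ∧
      innerCount p.1 1 p.2 = spokeCount p.1 1 p.2 := by
  decide +kernel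

theorem theorem1 (n j k : ℕ) (hn : 3 ≤ n) (hj : 1 ≤ j) (hk : 1 ≤ k)
    (hjn : 2 * j < n) (hkn : 2 * k < n) (hgcd : Nat.gcd n (Nat.gcd j k) = 1) :
    (∃ r : ℕ, (iGraph n j k).IsCycleRegular 1 r 8) ↔
      ∃ p ∈ ({(3, 1), (4, 1), (5, 2), (8, 3), (10, 2), (10, 3), (12, 5), (13, 5),
          (24, 5), (26, 5)} : Set (ℕ × ℕ)),
        Nonempty (iGraph n j k ≃g generalizedPetersen p.1 p.2) := by
  have h : IGraphParams n j k := ⟨hj, hk, hjn, hkn⟩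
  have hset : ∀ p : ℕ × ℕ, p ∈ ({(3, 1), (4, 1), (5, 2), (8, 3), (10, 2), (10, 3), (12, 5), (13, 5),
      (24, 5), (26, 5)} : Set (ℕ × ℕ)) ↔ p ∈ exceptionalParams := fun p => by
    simp [exceptionalParams]
  simp only [hset]
  constructor
  · rintro ⟨r, hr⟩
    obtain ⟨ho, hi, hs⟩ := (h.isCycleRegular_iff r).1 hr
    have h26 := h.le_of_counts_eq hgcd (ho.trans hs.symm) (hi.trans hs.symm)
    obtain ⟨p, hp, rfl, hm⟩ := isMultipleOfCountsEq_of_lt n (by omega) j (by omega) k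
      (by omega) ⟨hj, hk, hjn, hkn⟩ hgcd (ho.trans hs.symm) (hi.trans hs.symm)
    refine ⟨p, hp, ?_⟩
    rcases hm with hm | hm
    · exact nonempty_iso_of_isMultiple (by omega) hm
    -- Here the multiplier takes `k` rather than `j` to 1, so the layers are exchanged first.
    · obtain ⟨f⟩ := nonempty_iso_of_isMultiple (by omega) hm
      exact ⟨(iGraphSwap _ j k).trans f⟩
  · rintro ⟨p, hp, ⟨f⟩⟩
    obtain ⟨⟨hp1, hp2, hp3⟩, ho, hi⟩ := exceptionalParams_counts p hp
    have h' : IGraphParams p.1 1 p.2 := ⟨le_rfl, hp1, hp2, hp3⟩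
    exact ⟨_, SimpleGraph.IsCycleRegular.of_iso f (by norm_num)
      ((h'.isCycleRegular_iff _).2 ⟨ho, hi, rfl⟩)⟩
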